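/- **Setting.** Fix positive integers $L,H,d_a,V,N$ and put $d_x=Hd_a$. A depth-$L$, $H$-headed, width-$d_x$ self-attention network has learned parameters $\theta=(\mathcal W,M^{\mathrm V})$: matrices $W^{\mathrm K,l,h},W^{\mathrm Q,l,h},W^{\mathrm V,l,h}\in\mathbb R^{d_a\times d_x}$ and $W^{\mathrm O,l,h}\in\mathbb R^{d_x\times d_a}$ for each layer $l$ and head $h$, and a vocabulary matrix $M^{\mathrm V}\in\mathbb R^{d_x\times V}$, whose $w$-th column $E_{M^{\mathrm V}}(w)$ is the embedding of the word $w\in[V]$. On input vectors $\mathbf x^1,\dots,\mathbf x^N\in\mathbb R^{d_x}$ it computes $\mathbf g^{i,0}=\mathbf x^i$ and $$\mathbf g^{i,l+1}=\sum_{h=1}^H W^{\mathrm O,l,h}\sum_{j=1}^N\langle W^{\mathrm Q,l,h}\mathbf g^{i,l},W^{\mathrm K,l,h}\mathbf g^{j,l}\rangle\, W^{\mathrm V,l,h}\mathbf g^{j,l}.$$ Its output $\mathbf y_\theta^{i}(w^1,\dots,w^N)$ is $\mathbf g^{i,L}$ for $\mathbf x^j=E_{M^{\mathrm V}}(w^j)$.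 Let $S_1=(w_1^1,\dots,w_1^N)$, with following word $w_1^{N+1}$, and $S_2=(w_2^1,\dots,w_2^N)$ be sentences, and $$\mathcal L(S_1)=-\sum_{j=1}^N\log\Big[\mathrm{softmax}\big\{(M^{\mathrm V})^\top\mathbf y_\theta^{j}(S_1)\big\}_{w_1^{j+1}}\Big].$$ The sequential representation with learning rate $\eta$ is $\mathbf y^{i}_{\theta'}(S_2)$, where $\theta'=\theta-\eta\,\partial\mathcal L(S_1)/\partial\theta$; its $p$-th entry is denoted $y=y^{(p,i),L,d_x,\eta}_{\mathrm{sequential}}$. For $\mathbf a,\mathbf b\in\mathbb R^{d_x}$ let $\mathcal L(S_1;\mathbf a)$ be the loss computed with each input embedding $E_{M^{\mathrm V}}(w_1^j)$ replaced by its entrywise product with $\mathbf a$, and let $\mathcal Z_y(\mathbf a,\mathbf b)$ be the $p$-th entry at location $i$ of the network with parameters $\theta-\eta\,\partial\mathcal L(S_1;\mathbf a)/\partial\theta$, evaluated on $S_2$ with each (updated) input embedding multiplied entrywise by $\mathbf b$. The separation rank $\mathrm{sep}(f)$ of $f:A\times B\to\mathbb R$ is the least $R\in\mathbb N$ such that $f(\mathbf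 a,\mathbf b)=\sum_{r=1}^R g_r(\mathbf a)g'_r(\mathbf b)$ for some functions $g_r:A\to\mathbb R$, $g_r':B\to\mathbb R$; $\varepsilon\text{-}\mathrm{sep}(f)$ is the least $R'\le\mathrm{sep}(f)$ in $\mathbb N$ that is the separation rank of some $\tilde f$ with $|\tilde f-f|\le\varepsilon$ on $A\times B$. Let $A,B\subseteq\mathbb R^{d_x}$ be the domains of $\mathbf a$ and $\mathbf b$; $\varepsilon\text{-seq-sep}(y)$ is $\varepsilon\text{-}\mathrm{sep}$ of $\mathcal Z_y$ on $A\times B$. **Theorem.** Assume that for some $0<\Lambda_{\min}\le\Lambda_{\max}$ every scalar parameter satisfies $\Lambda_{\min}\le|\theta|\le\Lambda_{\max}$, and $\Lambda_{\min}\le|\partial\mathcal L(S_1;\mathbf a)/\partial\theta|\le\Lambda_{\max}$ for all $\mathbf a\in A$; that $N<d_x$, $\eta\in(0,1]$, $\frac{2(1+\eta)d_x}{\eta}<3^L$ and $2(1+\eta)d_x^2<3^L$; and that $\mathcal Z_y$ can be written on $A\times B$ as a finite sum of terms, the absolute values of which add up to less than some $M\ge0$ at every point of $A\times B$. Then, for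 every $\varepsilon>0$, $\varepsilon\text{-seq-sep}(y)$ is finite and $$\log\big[\varepsilon\text{-seq-sep}(y)\big]=\tilde O\big([L+0.5\log_3\eta]\cdot d_x\big),$$ that is, the left side is at most $C\,(1+\log d_x+\log L+\log H)^{\kappa}\,[L+0.5\log_3\eta]\,d_x$ with universal constants $C>0$ and $\kappa\in\mathbb N$, independent of $L,H,d_x,N,V,\eta,\varepsilon,\Lambda_{\min},\Lambda_{\max},M,\theta,S_1,S_2,A,B,p,i$. (If the rank is $0$, the left side is read as $0$, and the right side is nonnegative.) -/

import Mathlib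

noncomputable section

namespace SeqNLM

open scoped Matrix

/-! ### Separation rank -/

/-- The separation rank of `y : α → β → ℝ` with respect to its two groups of variables: the least
number of multiplicatively separable summands adding up to `y` (and `⊤` if there is no finite such
number). -/
def sepRank {α β : Type*} (y : α → β → ℝ) : ℕ∞ :=
  sInf {R : ℕ∞ | ∃ n : ℕ, R = (n : ℕ∞) ∧
    ∃ (g : Fin n → α → ℝ) (g' : Fin n → β → ℝ), ∀ a b, y a b = ∑ r, g r a * g' r b}

/-- The effective (`ε`-) separation rank: the least finite separation rank, not exceeding the one
of `y`, of a function that is uniformly within `ε` of `y`. -/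
def epsSepRank {α β : Type*} (ε : ℝ) (y : α → β → ℝ) : ℕ∞ :=
  sInf {R : ℕ∞ | ∃ n : ℕ, R = (n : ℕ∞) ∧ R ≤ sepRank y ∧
    ∃ y' : α → β → ℝ, sepRank y' = R ∧ ∀ a b, |y' a b - y a b| ≤ ε}

/-! ### The network -/

/-- Indices of the scalar learned parameters of a depth `L` network with `H` heads, head dimension
`da`, width `dx` and vocabulary size `V`: the entries of the key, query, value and output matrices
of every layer and head, and those of the `dx × V` vocabulary embedding matrix. -/
inductive ParamIdx (L H da dx V : ℕ) : Type
  | key (l : Fin L) (h : Fin H) (r : Fin da) (α : Fin dx)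
  | query (l : Fin L) (h : Fin H) (r : Fin da) (α : Fin dx)
  | value (l : Fin L) (h : Fin H) (r : Fin da) (α : Fin dx)
  | output (l : Fin L) (h : Fin H) (α : Fin dx) (r : Fin da)
  | vocab (α : Fin dx) (w : Fin V)
  deriving DecidableEq

/-- An assignment of all learned parameters. -/
abbrev Params (L H da dx V : ℕ) : Type := ParamIdx L H da dx V → ℝ

variable {L H da dx V N : ℕ}

def Params.WK (θ : Params L H da dx V) (l : Fin L) (h : Fin H) : Matrix (Fin da) (Fin dx) ℝ :=
  Matrix.of fun r α => θ (.key l h r α)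

def Params.WQ (θ : Params L H da dx V) (l : Fin L) (h : Fin H) : Matrix (Fin da) (Fin dx) ℝ :=
  Matrix.of fun r α => θ (.query l h r α)

def Params.WV (θ : Params L H da dx V) (l : Fin L) (h : Fin H) : Matrix (Fin da) (Fin dx) ℝ :=
  Matrix.of fun r α => θ (.value l h r α)

def Params.WO (θ : Params L H da dx V) (l : Fin L) (h : Fin H) : Matrix (Fin dx) (Fin da) ℝ :=
  Matrix.of fun α r => θ (.output l h α r)

/-- The word embedding of `w`: the `w`-th column of the vocabulary embedding matrix. -/
def embed (θ : Params L H da dx V) (w : Fin V) : Fin dx → ℝ := fun α => θ (.vocab α w)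

/-- One self-attention layer, without softmax and ReLU, with the weights of layer `l`. -/
def attnLayer (θ : Params L H da dx V) (l : Fin L) (x : Fin N → Fin dx → ℝ) (i : Fin N) :
    Fin dx → ℝ :=
  ∑ h : Fin H, θ.WO l h *ᵥ ∑ j : Fin N,
    ((θ.WQ l h *ᵥ x i) ⬝ᵥ (θ.WK l h *ᵥ x j)) • (θ.WV l h *ᵥ x j)

/-- The activations after the first `l` layers on the input vectors `x`. -/
def hidden (θ : Params L H da dx V) (x : Fin N → Fin dx → ℝ) :
    (l : ℕ) → l ≤ L → Fin N → Fin dx → ℝ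
  | 0, _ => x
  | l + 1, h => attnLayer θ ⟨l, h⟩ (hidden θ x l (Nat.le_of_succ_le h))

/-- The self-attention stack: all `L` layers. -/
def stack (θ : Params L H da dx V) (x : Fin N → Fin dx → ℝ) : Fin N → Fin dx → ℝ :=
  hidden θ x L le_rfl

/-- The network output on a sequence of words. -/
def transformer (θ : Params L H da dx V) (w : Fin N → Fin V) : Fin N → Fin dx → ℝ :=
  stack θ fun j => embed θ (w j)

/-- The network output when the sentence association layer with variable `s` is applied to the
input embeddings: each embedding is multiplied entrywise by `s`. -/
def transformerAssoc (θ : Params L H da dx V) (s : Fin dx → ℝ) (w : Fin N → Fin V) :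
    Fin N → Fin dx → ℝ :=
  stack θ fun j => embed θ (w j) * s

/-! ### The loss, the gradient step and the sequential representation -/

/-- The `w`-th entry of the softmax of a vector of logits. -/
def softmax (z : Fin V → ℝ) (w : Fin V) : ℝ := Real.exp (z w) / ∑ v, Real.exp (z v)

/-- The logits of an output vector `y`: the transposed vocabulary matrix applied to `y`. -/
def logits (θ : Params L H da dx V) (y : Fin dx → ℝ) : Fin V → ℝ := fun v => embed θ v ⬝ᵥ y

/-- The autoregressive negative log-likelihood of a sentence. The words `S 0, …, S (N-1)` are
the input, and the target at position `j` is the next word `S (j+1)`; so `S N` is the word that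
follows the sentence. -/
def loss (S : Fin (N + 1) → Fin V) (θ : Params L H da dx V) : ℝ :=
  -∑ j : Fin N, Real.log
    (softmax (logits θ (transformer θ (fun k : Fin N => S k.castSucc) j)) (S j.succ))

/-- The same loss, with the sentence association layer with variable `a` applied to all uses of
the input embedding layer. -/
def lossAssoc (S : Fin (N + 1) → Fin V) (a : Fin dx → ℝ) (θ : Params L H da dx V) : ℝ :=
  -∑ j : Fin N, Real.log
    (softmax (logits θ (transformerAssoc θ a (fun k : Fin N => S k.castSucc) j)) (S j.succ))

/-- The partial derivative of `f` with respect to the scalar parameter `k`, at `θ`. -/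
def partialDeriv (f : Params L H da dx V → ℝ) (θ : Params L H da dx V)
    (k : ParamIdx L H da dx V) : ℝ :=
  deriv (fun t : ℝ => f (Function.update θ k t)) (θ k)

/-- One gradient step of learning rate `η` on the loss `f`, for all learned parameters. -/
def gradStep (η : ℝ) (f : Params L H da dx V → ℝ) (θ : Params L H da dx V) :
    Params L H da dx V :=
  fun k => θ k - η * partialDeriv f θ k

/-- The sequential representation: one gradient step on `S₁`, then evaluation on `S₂`. -/
def seqRep (θ : Params L H da dx V) (η : ℝ) (S₁ : Fin (N + 1) → Fin V) (S₂ : Fin N → Fin V) :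
    Fin N → Fin dx → ℝ :=
  transformer (gradStep η (loss S₁) θ) S₂

/-- The sentence association operation on the sequential representation: every embedding used as
input because of `S₁` is multiplied entrywise by `a`, and every one used because of `S₂` by `b`.
-/
def seqRepAssoc (θ : Params L H da dx V) (η : ℝ) (S₁ : Fin (N + 1) → Fin V) (S₂ : Fin N → Fin V)
    (a b : Fin dx → ℝ) : Fin N → Fin dx → ℝ :=
  transformerAssoc (gradStep η (lossAssoc S₁ a) θ) b S₂

/-- With both association variables equal to the all-ones vector, nothing changes. -/
theorem seqRepAssoc_one (θ : Params L H da dx V) (η : ℝ) (S₁ : Fin (N + 1) → Fin V)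
    (S₂ : Fin N → Fin V) : seqRepAssoc θ η S₁ S₂ 1 1 = seqRep θ η S₁ S₂ := by
  have h : lossAssoc (L := L) (H := H) (da := da) (dx := dx) S₁ 1 = loss S₁ := by
    funext θ'
    simp [lossAssoc, loss, transformerAssoc, transformer]
  simp [seqRepAssoc, seqRep, transformerAssoc, transformer, h]

/-- The `ε`-sequential-separation rank of entry `p` at location `i` of the sequential
representation, where the association variables `a` and `b` range over `A` and `B`. -/
def epsSeqSep (ε : ℝ) (θ : Params L H da dx V) (η : ℝ) (S₁ : Fin (N + 1) → Fin V)
    (S₂ : Fin N → Fin V) (A B : Set (Fin dx → ℝ)) (p : Fin dx) (i : Fin N) : ℕ∞ :=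
  epsSepRank ε fun (a : A) (b : B) => seqRepAssoc θ η S₁ S₂ a b i p

end SeqNLM

end

open SeqNLM

namespace SeqNLM

open scoped Matrix

/-! The bound already holds for the exact separation rank. Once `a` is fixed, the gradient step
produces a fixed parameter vector, so `b` enters only through the input embeddings, linearly. Each
attention layer is cubic in its input, hence the output is a polynomial in `b` of degree at most `3
^ L` (`isPolyOfDegree_hidden`). Expanding it in monomials whose exponents are all at most `3 ^ L`
separates the variables: coefficients depend on `a`, monomials on `b`, and there are `(3 ^ L + 1) ^
dx` of them (`epsSeqSep_le`). The logarithm is of order `L * dx`, and the condition on `η` makes `L`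
at most twice `L + 0.5 * logb 3 η` (`half_mul_le_add_half_logb`). -/

/-- `f` is the evaluation of a polynomial of total degree at most `D`. -/
def IsPolyOfDegree {σ : Type*} (D : ℕ) (f : (σ → ℝ) → ℝ) : Prop :=
  ∃ P : MvPolynomial σ ℝ, P.totalDegree ≤ D ∧ ∀ b, f b = MvPolynomial.eval b P

namespace IsPolyOfDegree

variable {σ : Type*} {D E : ℕ} {f g : (σ → ℝ) → ℝ}

theorem const_mul (c : ℝ) (hf : IsPolyOfDegree D f) : IsPolyOfDegree D fun b => c * f b := by
  obtain ⟨P, hP, h⟩ := hf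
  refine ⟨MvPolynomial.C c * P, ?_, fun b => by simp [h]⟩
  refine (MvPolynomial.totalDegree_mul _ _).trans ?_
  simpa using hP

theorem mul (hf : IsPolyOfDegree D f) (hg : IsPolyOfDegree E g) :
    IsPolyOfDegree (D + E) fun b => f b * g b := by
  obtain ⟨P, hP, h⟩ := hf
  obtain ⟨Q, hQ, h'⟩ := hg
  exact ⟨P * Q, (MvPolynomial.totalDegree_mul _ _).trans (add_le_add hP hQ),
    fun b => by simp [h, h']⟩

theorem sum {ι : Type*} (s : Finset ι) {F : ι → (σ → ℝ) → ℝ}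
    (hF : ∀ i ∈ s, IsPolyOfDegree D (F i)) : IsPolyOfDegree D fun b => ∑ i ∈ s, F i b := by
  choose! P hP h using hF
  refine ⟨∑ i ∈ s, P i, MvPolynomial.totalDegree_finsetSum_le hP, fun b => ?_⟩
  rw [map_sum]
  exact Finset.sum_congr rfl fun i hi => h i hi b

theorem coord (α : σ) : IsPolyOfDegree 1 fun b : σ → ℝ => b α :=
  ⟨MvPolynomial.X α, by simp, fun b => by simp⟩

theorem mulVec {m n : Type*} [Fintype n] (W : Matrix m n ℝ) {x : (σ → ℝ) → n → ℝ}
    (hx : ∀ k, IsPolyOfDegree D fun b => x b k) (r : m) :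
    IsPolyOfDegree D fun b => (W *ᵥ x b) r :=
  sum Finset.univ fun k _ => (hx k).const_mul (W r k)

theorem dotProduct {n : Type*} [Fintype n] {x y : (σ → ℝ) → n → ℝ}
    (hx : ∀ k, IsPolyOfDegree D fun b => x b k) (hy : ∀ k, IsPolyOfDegree E fun b => y b k) :
    IsPolyOfDegree (D + E) fun b => x b ⬝ᵥ y b :=
  sum Finset.univ fun k _ => (hx k).mul (hy k)

/-- Expansion in the monomials whose exponents are at most the degree bound. -/
theorem exists_coeff {σ : Type*} [Fintype σ] [DecidableEq σ] {D : ℕ} {f : (σ → ℝ) → ℝ}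
    (hf : IsPolyOfDegree D f) :
    ∃ c : (σ → Fin (D + 1)) → ℝ, ∀ b, f b = ∑ e, c e * ∏ α, b α ^ (e α : ℕ) := by
  obtain ⟨P, hP, h⟩ := hf
  let φ : (σ → Fin (D + 1)) → σ →₀ ℕ := fun e => Finsupp.equivFunOnFinite.symm fun α => (e α : ℕ)
  have hφ : Function.Injective φ := fun e e' he => by
    ext α
    exact DFunLike.congr_fun he α
  refine ⟨fun e => P.coeff (φ e), fun b => ?_⟩
  rw [h, MvPolynomial.eval_eq']
  -- A single exponent is at most the total degree, so the box of exponents contains the support;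
  -- the additional coefficients vanish.
  have hsub : P.support ⊆ Finset.univ.image φ := fun d hd => by
    have hd' : ∀ α, d α < D + 1 := fun α =>
      Nat.lt_succ_of_le ((Finsupp.le_degree α d).trans
        ((MvPolynomial.le_totalDegree hd).trans hP))
    refine Finset.mem_image.2 ⟨fun α => ⟨d α, hd' α⟩, Finset.mem_univ _, ?_⟩
    ext α
    rfl
  rw [Finset.sum_subset hsub fun d _ hd => by
    rw [MvPolynomial.notMem_support_iff.1 hd, zero_mul], Finset.sum_image hφ.injOn]
  rfl

end IsPolyOfDegree

theorem sepRank_le_card {α β ι : Type*} [Fintype ι] {y : α → β → ℝ} (g : ι → α → ℝ)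
    (g' : ι → β → ℝ) (h : ∀ a b, y a b = ∑ r, g r a * g' r b) :
    sepRank y ≤ (Fintype.card ι : ℕ) := by
  refine sInf_le ⟨_, rfl, fun r => g ((Fintype.equivFin ι).symm r),
    fun r => g' ((Fintype.equivFin ι).symm r), fun a b => ?_⟩
  rw [h]
  exact ((Fintype.equivFin ι).symm.sum_comp fun r => g r a * g' r b).symm

/-- A function of finite rank is its own `ε`-approximation. -/
theorem epsSepRank_le_sepRank {α β : Type*} {ε : ℝ} (hε : 0 ≤ ε) (y : α → β → ℝ) :
    epsSepRank ε y ≤ sepRank y := by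
  by_cases htop : sepRank y = ⊤
  · simp [htop]
  · obtain ⟨n, hn⟩ := ENat.ne_top_iff_exists.1 htop
    exact sInf_le ⟨n, hn.symm, le_rfl, y, rfl, fun a b => by simpa using hε⟩

/-- The `ε`-separation rank of a function that is polynomial in its second group of variables. -/
theorem epsSepRank_le_of_isPolyOfDegree {α σ : Type*} [Fintype σ] {D : ℕ} {ε : ℝ} (hε : 0 ≤ ε)
    {y : α → (σ → ℝ) → ℝ} (hy : ∀ a, IsPolyOfDegree D (y a)) (B : Set (σ → ℝ)) :
    epsSepRank ε (fun (a : α) (b : B) => y a b) ≤ ((D + 1) ^ Fintype.card σ : ℕ) := by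
  classical
  -- The factors of a separable term need no regularity, so coefficients may be chosen separately
  -- for each `a`.
  choose c hc using fun a => (hy a).exists_coeff
  refine (epsSepRank_le_sepRank hε _).trans ?_
  have := sepRank_le_card (y := fun (a : α) (b : B) => y a b) (fun e a => c a e)
    (fun e b => ∏ s, (b : σ → ℝ) s ^ (e s : ℕ)) fun a b => hc a b
  simpa using this

section Network

variable {L H da dx V N : ℕ}

/-- Query, key and value are each linear in the layer's input and get multiplied together,
contributing `D` apiece. -/
theorem isPolyOfDegree_attnLayer {σ : Type*} {D : ℕ} (θ : Params L H da dx V) (l : Fin L)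
    {x : (σ → ℝ) → Fin N → Fin dx → ℝ} (hx : ∀ j α, IsPolyOfDegree D fun b => x b j α)
    (i : Fin N) (α : Fin dx) :
    IsPolyOfDegree (3 * D) fun b => attnLayer θ l (x b) i α := by
  have key : IsPolyOfDegree (3 * D) fun b => ∑ h : Fin H, (θ.WO l h *ᵥ ∑ j : Fin N,
      ((θ.WQ l h *ᵥ x b i) ⬝ᵥ (θ.WK l h *ᵥ x b j)) • (θ.WV l h *ᵥ x b j)) α := by
    refine .sum _ fun h _ => .mulVec _ (fun r => ?_) α
    simp only [Finset.sum_apply, Pi.smul_apply, smul_eq_mul]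
    refine .sum _ fun j _ => ?_
    have hq := IsPolyOfDegree.mulVec (θ.WQ l h) (hx i)
    have hk := IsPolyOfDegree.mulVec (θ.WK l h) (hx j)
    have hv := IsPolyOfDegree.mulVec (θ.WV l h) (hx j) r
    rw [show 3 * D = D + D + D by ring]
    exact (IsPolyOfDegree.dotProduct hq hk).mul hv
  simpa only [attnLayer, Finset.sum_apply] using key

/-- Every layer triples the degree in the variables the input depends on. -/
theorem isPolyOfDegree_hidden {σ : Type*} {D : ℕ} (θ : Params L H da dx V)
    {x : (σ → ℝ) → Fin N → Fin dx → ℝ} (hx : ∀ j α, IsPolyOfDegree D fun b => x b j α)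
    (l : ℕ) (hl : l ≤ L) (i : Fin N) (α : Fin dx) :
    IsPolyOfDegree (3 ^ l * D) fun b => hidden θ (x b) l hl i α := by
  induction l generalizing i α with
  | zero => simpa [hidden] using hx i α
  | succ l ih =>
    rw [pow_succ', mul_assoc]
    exact isPolyOfDegree_attnLayer θ ⟨l, hl⟩ (ih (Nat.le_of_succ_le hl)) i α

theorem isPolyOfDegree_transformerAssoc (θ : Params L H da dx V) (w : Fin N → Fin V)
    (i : Fin N) (p : Fin dx) :
    IsPolyOfDegree (3 ^ L) fun b => transformerAssoc θ b w i p := by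
  have := isPolyOfDegree_hidden (D := 1) θ (x := fun b j => embed θ (w j) * b)
    (fun j α => (IsPolyOfDegree.coord α).const_mul (embed θ (w j) α)) L le_rfl i p
  rwa [mul_one] at this

theorem epsSeqSep_le {ε : ℝ} (hε : 0 ≤ ε) (θ : Params L H da dx V) (η : ℝ)
    (S₁ : Fin (N + 1) → Fin V) (S₂ : Fin N → Fin V) (A B : Set (Fin dx → ℝ)) (p : Fin dx)
    (i : Fin N) : epsSeqSep ε θ η S₁ S₂ A B p i ≤ ((3 ^ L + 1) ^ dx : ℕ) := by
  have hpoly (a : A) : IsPolyOfDegree (3 ^ L) fun b => seqRepAssoc θ η S₁ S₂ a b i p := by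
    simp only [seqRepAssoc]
    exact isPolyOfDegree_transformerAssoc _ S₂ i p
  have := epsSepRank_le_of_isPolyOfDegree hε hpoly B
  rwa [Fintype.card_fin] at this

end Network

theorem log_three_pow_add_one_le {L : ℕ} (hL : 1 ≤ L) :
    Real.log (3 ^ L + 1) ≤ 2 * Real.log 3 * L := by
  have h1 : (1 : ℝ) < 3 ^ L := one_lt_pow₀ (by norm_num) (by omega)
  have h2 : (3 : ℝ) ^ L + 1 ≤ 3 ^ (2 * L) := by
    rw [two_mul, pow_add]
    have h3 : (3 : ℝ) ≤ 3 ^ L := le_self_pow₀ (by norm_num) (by omega)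
    nlinarith
  refine (Real.log_le_log (by positivity) h2).trans_eq ?_
  rw [Real.log_pow]
  push_cast
  ring

/-- The hypothesis gives `1 / η < 3 ^ L`, since `2 * (1 + η) * d ≥ 1`. So `logb 3 η ≥ -L`, and half
of it costs at most half of `L`. -/
theorem half_mul_le_add_half_logb {L : ℕ} {d η : ℝ} (hd : 1 ≤ d) (hη : 0 < η)
    (h : 2 * (1 + η) * d / η < 3 ^ L) : 0.5 * L ≤ L + 0.5 * Real.logb 3 η := by
  have h1 : (3 : ℝ) ^ (-(L : ℝ)) ≤ η := by
    rw [Real.rpow_neg (by norm_num), Real.rpow_natCast]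
    refine inv_le_of_inv_le₀ hη (le_trans ?_ h.le)
    rw [inv_eq_one_div]
    gcongr
    nlinarith
  have h2 : -(L : ℝ) ≤ Real.logb 3 η := (Real.le_logb_iff_rpow_le (by norm_num) hη).2 h1
  linarith

end SeqNLM

theorem theorem1 :
    ∃ (C : ℝ) (κ : ℕ), 0 < C ∧
      ∀ (L H da dx V N : ℕ), H * da = dx → N < dx →
      ∀ (η : ℝ), 0 < η → η ≤ 1 →
        2 * (1 + η) * (dx : ℝ) / η < 3 ^ L →
        2 * (1 + η) * (dx : ℝ) ^ 2 < 3 ^ L →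
      ∀ (θ : Params L H da dx V) (S₁ : Fin (N + 1) → Fin V) (S₂ : Fin N → Fin V)
        (A B : Set (Fin dx → ℝ)) (p : Fin dx) (i : Fin N)
        (Λmin Λmax : ℝ), 0 < Λmin → Λmin ≤ Λmax →
        -- all parameters, and all gradients of the loss on `S₁`, are bounded
        (∀ k, Λmin ≤ |θ k| ∧ |θ k| ≤ Λmax) →
        (∀ a ∈ A, ∀ k, Λmin ≤ |partialDeriv (lossAssoc S₁ a) θ k| ∧
          |partialDeriv (lossAssoc S₁ a) θ k| ≤ Λmax) →
        -- a representation as a sum of terms whose sum of absolute values is below `M`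
      ∀ (M : ℝ), 0 ≤ M →
      ∀ (n : ℕ) (term : Fin n → (Fin dx → ℝ) → (Fin dx → ℝ) → ℝ),
        (∀ a ∈ A, ∀ b ∈ B, seqRepAssoc θ η S₁ S₂ a b i p = ∑ m, term m a b) →
        (∀ a ∈ A, ∀ b ∈ B, ∑ m, |term m a b| < M) →
      ∀ (ε : ℝ), 0 < ε →
        ∃ R : ℕ, epsSeqSep ε θ η S₁ S₂ A B p i = (R : ℕ∞) ∧
          Real.log R ≤
            C * (1 + Real.log dx + Real.log L + Real.log H) ^ κ *
              ((L + 0.5 * Real.logb 3 η) * dx) := by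
  have hlog3 : 0 < Real.log 3 := Real.log_pos (by norm_num)
  -- One factor 2 comes from `3 ^ L + 1 ≤ 3 ^ (2 * L)`, the other from absorbing `logb 3 η`. No
  -- logarithmic factor arises, so `κ = 0`.
  refine ⟨4 * Real.log 3, 0, by positivity, ?_⟩
  intro L H da dx V N _ hN η hη _ hL hL2 θ S₁ S₂ A B p i _ _ _ _ _ _ _ _ _ _ _ _ ε hε
  have hdx : (1 : ℝ) ≤ dx := by exact_mod_cast (by omega : 1 ≤ dx)
  -- Depth 0 would force `2 * (1 + η) * dx ^ 2 < 1`.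
  have hL1 : 1 ≤ L := by
    by_contra hL0
    obtain rfl : L = 0 := by omega
    rw [pow_zero] at hL2
    nlinarith
  have hle := epsSeqSep_le hε.le θ η S₁ S₂ A B p i
  obtain ⟨R, hR⟩ := ENat.ne_top_iff_exists.1 (ne_top_of_le_ne_top (ENat.natCast_ne_top _) hle)
  refine ⟨R, hR.symm, ?_⟩
  rw [← hR, Nat.cast_le] at hle
  have hlog : Real.log R ≤ dx * Real.log (3 ^ L + 1) := by
    rw [← Real.log_pow]
    -- Rank 0 is separate: there `Real.log 0 = 0`, and monotonicity of the logarithm does not apply.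
    rcases Nat.eq_zero_or_pos R with rfl | hpos
    · rw [Nat.cast_zero, Real.log_zero]
      exact Real.log_nonneg (one_le_pow₀ (by linarith [pow_pos (by norm_num : (0 : ℝ) < 3) L]))
    · exact Real.log_le_log (by exact_mod_cast hpos) (by exact_mod_cast hle)
  calc Real.log R ≤ dx * Real.log (3 ^ L + 1) := hlog
    _ ≤ dx * (2 * Real.log 3 * L) := by gcongr; exact log_three_pow_add_one_le hL1
    _ = 4 * Real.log 3 * ((0.5 * L) * dx) := by ring
    _ ≤ 4 * Real.log 3 * ((L + 0.5 * Real.logb 3 η) * dx) := by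
      gcongr
      exact half_mul_le_add_half_logb hdx hη hL
    _ = _ := by rw [pow_zero, mul_one]
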